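/- Let $R$ be a noetherian ring (associative, with $1$) with centre $Z(R)$, and let $C \subseteq Z(R)$ be a subring such that $R$ is a finitely generated $C$-module. For $A = C$ or $A = Z(R)$ (both are then commutative noetherian rings over which $R$ is a finitely generated module) and a maximal ideal $\mathfrak m$ of $A$, let $G_A(\mathfrak m, R)$ be the length of a maximal $A$-regular sequence in $\mathfrak m$ on the $A$-module $R$. The ring $R$ is called $A$-Macaulay if it is a maximal Cohen--Macaulay $A$-module, that is, if $$G_A(\mathfrak m,R) = \mathrm{Kdim}_{A_{\mathfrak m}}(R_{\mathfrak m}) = \mathrm{Kdim}(A_{\mathfrak m})$$ for every maximal ideal $\mathfrak m$ of $A$. (1) Suppose that $R$ is $Z(R)$-Macaulay. Then $R$ is $C$-Macaulay if and only if, for all maximal ideals $M$ and $N$ of $Z(R)$ with $M \cap C = N \cap C$, one has $\mathrm{ht}(M) = \mathrm{ht}(N)$. (2) Suppose that $Z(R)$ is equicodimensional, i.e. all maximal ideals of $Z(R)$ have the same height. Then $R$ is $Z(R)$-Macaulay if and only if $R$ is $C$-Macaulay. -/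

import Mathlib

namespace CentrallyMacaulay

/-- The grade `G_A(I, X)`: the supremum of the lengths of the `A`-regular sequences on `X` whose
terms lie in `I`. If `A` is noetherian, `X` is finitely generated and `I X ≠ X`, this is the
common length of all maximal regular sequences on `X` in `I`. -/
noncomputable def idealGrade (A : Type*) [CommRing A] (I : Ideal A) (X : Type*) [AddCommGroup X]
    [Module A X] : ℕ∞ :=
  ⨆ (xs : List A) (_ : ∀ x ∈ xs, x ∈ I) (_ : RingTheory.Sequence.IsRegular X xs),
    (xs.length : ℕ∞)

/-- `X` is a Cohen-Macaulay `A`-module: at every maximal ideal `m` of `A`, the grade of `m` on `X`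
is the Krull dimension of the `A_m`-module `X_m`. -/
def IsCohenMacaulayModule (A : Type*) [CommRing A] (X : Type*) [AddCommGroup X]
    [Module A X] : Prop :=
  ∀ (m : Ideal A) [m.IsMaximal],
    (idealGrade A m X : WithBot ℕ∞) =
      Module.supportDim (Localization.AtPrime m) (LocalizedModule.AtPrime m X)

/-- `X` is a maximal Cohen-Macaulay `A`-module: it is Cohen-Macaulay, and at every maximal ideal
`m` of `A` the grade of `m` on `X` is the Krull dimension of the local ring `A_m`. -/
def IsMaximalCohenMacaulayModule (A : Type*) [CommRing A] (X : Type*) [AddCommGroup X]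
    [Module A X] : Prop :=
  IsCohenMacaulayModule A X ∧
    ∀ (m : Ideal A) [m.IsMaximal],
      (idealGrade A m X : WithBot ℕ∞) = ringKrullDim (Localization.AtPrime m)

/-- The ring `R` is `C`-Macaulay, where `C` acts on `R` (in the intended use: `C` is a central
subring of `R` over which `R` is a finite module, or the centre of `R` itself). -/
def IsMacaulayOver (C R : Type*) [CommRing C] [Ring R] [Module C R] : Prop :=
  IsMaximalCohenMacaulayModule C R

/-- A commutative ring is equicodimensional if all its maximal ideals have the same height. -/
def IsEquicodimensional (A : Type*) [CommRing A] : Prop :=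
  ∀ M N : Ideal A, M.IsMaximal → N.IsMaximal → M.height = N.height

end CentrallyMacaulay

/-! By Eakin-Nagata-Formanek `R` is a noetherian `C`-module, so `A = C` is noetherian, `B = Z(R)` is
finite over it, and `X = R` is finite and faithful over both. Faithfulness turns the Macaulay
condition into "grade = height" at every maximal ideal. For a maximal `M` of `B` over `m` in `A`,
grade `m` ≤ grade `M` ≤ ht `M` ≤ ht `m`. If `X` is Macaulay over `A` the ends agree, so `X` is
Macaulay over `B` and ht `M` depends only on `m`. Conversely, some `M` over `m` is as high as `m` by
going up; if all `M` over `m` have that height, each contains a regular sequence of that length, and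
`exists_isWeaklyRegular_map_of_forall_comap_eq` produces one in `m`. -/

/-! ### Eakin-Nagata-Formanek -/

/-- A finite module `Y` all of whose quotients `Y / cY` with `cY ≠ 0` are noetherian is
noetherian. -/
theorem isNoetherian_of_isNoetherian_quotient_smul {A Y : Type*} [CommRing A] [AddCommGroup Y]
    [Module A Y] [Module.Finite A Y]
    (h : ∀ c : A, c ∉ Module.annihilator A Y →
      IsNoetherian A (Y ⧸ LinearMap.range (LinearMap.lsmul A Y c))) :
    IsNoetherian A Y := by
  classical
  obtain ⟨s, hs⟩ := Module.Finite.fg_top (R := A) (M := Y)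
  have key : ∀ (N : Submodule A Y) (c : A), (∀ y : Y, c • y ∈ N) ↔ ∀ y ∈ s, c • y ∈ N := by
    intro N c
    refine ⟨fun H y _ ↦ H y, fun H y ↦ ?_⟩
    have : (⊤ : Submodule A Y) ≤ N.comap (LinearMap.lsmul A Y c) := by
      rw [← hs, Submodule.span_le]
      exact fun y hy ↦ H y hy
    exact this Submodule.mem_top
  -- These are the `N` for which `Y ⧸ N` has the same annihilator as `Y`; finite generation of `Y`
  -- makes the condition pass to unions of chains.
  let Γ : Set (Submodule A Y) := {N | ∀ c : A, (∀ y : Y, c • y ∈ N) → c ∈ Module.annihilator A Y}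
  obtain ⟨N, -, hN⟩ := zorn_le_nonempty₀ Γ (by
    intro K hK hchain N₀ hN₀
    refine ⟨sSup K, fun c hc ↦ ?_, fun z hz ↦ le_sSup hz⟩
    have hdir : DirectedOn (· ≤ ·) K := hchain.directedOn
    have hfin : (Submodule.span A ((fun y ↦ c • y) '' (s : Set Y))).FG :=
      Submodule.fg_span (s.finite_toSet.image _)
    obtain ⟨N, hNK, hle⟩ : ∃ N ∈ K, Submodule.span A ((fun y ↦ c • y) '' (s : Set Y)) ≤ N := by
      refine (CompleteLattice.isCompactElement_iff_le_of_directed_sSup_le (α := Submodule A Y) _).1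
        ((Submodule.fg_iff_compact _).1 hfin) K ⟨N₀, hN₀⟩ hdir ?_
      rw [Submodule.span_le]
      rintro _ ⟨y, -, rfl⟩
      exact hc y
    exact hK hNK c ((key N c).2 fun y hy ↦ hle (Submodule.subset_span ⟨y, hy, rfl⟩))) ⊥ (by
      intro c hc
      rw [Module.mem_annihilator]
      simpa using hc)
  -- By maximality of `N`, a nonzero submodule `P` contains `c(Y ⧸ N)` for some `c` not killing `Y`.
  -- This image is finitely generated, and the quotient by it is noetherian.
  have hquot : IsNoetherian A (Y ⧸ N) := by
    refine ⟨fun P ↦ ?_⟩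
    by_cases hP : P = ⊥
    · exact hP ▸ Submodule.fg_bot
    have hlt : ¬ P.comap N.mkQ ≤ N := by
      intro hle
      refine hP (Submodule.eq_bot_iff _ |>.2 fun p hp ↦ ?_)
      obtain ⟨y, rfl⟩ := N.mkQ_surjective p
      exact (Submodule.Quotient.mk_eq_zero N).2 (hle hp)
    obtain ⟨c, hcP, hc⟩ : ∃ c : A, (∀ y : Y, c • y ∈ P.comap N.mkQ) ∧
        c ∉ Module.annihilator A Y := by
      by_contra! H
      exact hlt (hN.2 (show P.comap N.mkQ ∈ Γ from H) (N.le_comap_mkQ P))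
    have := h c hc
    let Q : Submodule A (Y ⧸ N) := LinearMap.range (LinearMap.lsmul A (Y ⧸ N) c)
    have hQ : Q ≤ P := by
      rintro _ ⟨z, rfl⟩
      obtain ⟨y, rfl⟩ := N.mkQ_surjective z
      exact hcP y
    let f : (Y ⧸ LinearMap.range (LinearMap.lsmul A Y c)) →ₗ[A] (Y ⧸ N) ⧸ Q :=
      Submodule.liftQ _ (Q.mkQ ∘ₗ N.mkQ) (by
        rintro _ ⟨y, rfl⟩
        exact (Submodule.Quotient.mk_eq_zero Q).2 ⟨N.mkQ y, rfl⟩)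
    have hf : Function.Surjective f := by
      intro z
      obtain ⟨z, rfl⟩ := Q.mkQ_surjective z
      obtain ⟨y, rfl⟩ := N.mkQ_surjective z
      exact ⟨Submodule.Quotient.mk y, rfl⟩
    have : IsNoetherian A ((Y ⧸ N) ⧸ Q) :=
      isNoetherian_of_surjective f (LinearMap.range_eq_top.2 hf)
    refine Submodule.fg_of_fg_map_of_fg_inf_ker Q.mkQ (IsNoetherian.noetherian _) ?_
    rw [Submodule.ker_mkQ, inf_eq_right.2 hQ]
    have hfg := (Module.Finite.fg_top (R := A) (M := Y ⧸ N)).map (LinearMap.lsmul A (Y ⧸ N) c)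
    rwa [Submodule.map_top] at hfg
  -- Evaluation at the generators embeds `A ⧸ Ann Y` in a finite power of `Y ⧸ N`; in turn `Y` is a
  -- quotient of a finite power of `A ⧸ Ann Y`.
  let g : A →ₗ[A] (s → Y ⧸ N) :=
    LinearMap.pi fun y ↦ N.mkQ ∘ₗ LinearMap.toSpanSingleton A Y y
  have hg : LinearMap.ker g = Module.annihilator A Y := by
    ext c
    refine ⟨fun hc ↦ hN.1 c ((key N c).2 fun y hy ↦ ?_), fun hc ↦ ?_⟩
    · exact (Submodule.Quotient.mk_eq_zero N).1 (congrFun hc ⟨y, hy⟩)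
    · refine LinearMap.mem_ker.2 (funext fun y ↦ ?_)
      simp [g, Module.mem_annihilator.1 hc]
  have hA : IsNoetherian A (A ⧸ Module.annihilator A Y) := by
    rw [← hg]
    exact isNoetherian_of_injective (LinearMap.ker g |>.liftQ g le_rfl)
      (LinearMap.ker_eq_bot.1 (Submodule.ker_liftQ_eq_bot _ _ _ le_rfl))
  let φ (y : s) : (A ⧸ Module.annihilator A Y) →ₗ[A] Y :=
    Submodule.liftQ _ (LinearMap.toSpanSingleton A Y y) fun c hc ↦ by
      simp [Module.mem_annihilator.1 hc]
  refine isNoetherian_of_surjective (LinearMap.lsum A _ ℕ φ) (eq_top_iff.2 ?_)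
  rw [← hs, Submodule.span_le]
  intro y hy
  refine ⟨Pi.single ⟨y, hy⟩ (Submodule.Quotient.mk 1), ?_⟩
  rw [LinearMap.lsum_piSingle]
  exact one_smul A y

/-- **Eakin-Nagata-Formanek**: a left noetherian ring which is a finite module over a central
subring `A` is a noetherian `A`-module. -/
theorem Algebra.isNoetherian_of_isNoetherianRing_of_finite (A R : Type*) [CommRing A] [Ring R]
    [Algebra A R] [IsNoetherianRing R] [Module.Finite A R] : IsNoetherian A R := by
  by_contra hR
  obtain ⟨L, hL, hmax⟩ := set_has_maximal_iff_noetherian.mpr ‹IsNoetherianRing R›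
    {L : Ideal R | ¬ IsNoetherian A (R ⧸ L.restrictScalars A)} ⟨⊥, fun h ↦ hR <| by
      have e := Submodule.quotEquivOfEqBot (Submodule.restrictScalars A (⊥ : Ideal R)) (by simp)
      exact isNoetherian_of_linearEquiv e⟩
  refine hL (isNoetherian_of_isNoetherian_quotient_smul fun c hc ↦ ?_)
  have hcL : algebraMap A R c ∉ L := by
    refine fun hcL ↦ hc (Module.mem_annihilator.2 fun y ↦ ?_)
    obtain ⟨r, rfl⟩ := Submodule.mkQ_surjective _ y
    refine (Submodule.Quotient.mk_eq_zero _).2 ?_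
    change c • r ∈ L
    rw [Algebra.smul_def, Algebra.commutes]
    exact Ideal.mul_mem_left L r hcL
  let L' : Ideal R := L ⊔ Ideal.span {algebraMap A R c}
  have hL' : IsNoetherian A (R ⧸ L'.restrictScalars A) := by
    by_contra H
    refine hmax L' H (lt_of_le_of_ne le_sup_left fun heq ↦ hcL ?_)
    rw [heq]
    exact (le_sup_right : _ ≤ L') (Ideal.subset_span rfl)
  let Q := LinearMap.range (LinearMap.lsmul A (R ⧸ L.restrictScalars A) c)
  let f : (R ⧸ L'.restrictScalars A) →ₗ[A] (R ⧸ L.restrictScalars A) ⧸ Q :=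
    Submodule.liftQ _ (Q.mkQ ∘ₗ (L.restrictScalars A).mkQ) (by
      intro x hx
      obtain ⟨l, hl, z, hz, rfl⟩ := Submodule.mem_sup.1 (show x ∈ L' from hx)
      obtain ⟨r, rfl⟩ := Ideal.mem_span_singleton'.1 hz
      refine (Submodule.Quotient.mk_eq_zero Q).2 ⟨Submodule.Quotient.mk r, ?_⟩
      refine (Submodule.Quotient.eq _).2 ?_
      change c • r - (l + r * algebraMap A R c) ∈ L
      rw [Algebra.smul_def, Algebra.commutes]
      simpa using hl)
  refine isNoetherian_of_surjective f (LinearMap.range_eq_top.2 fun z ↦ ?_)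
  obtain ⟨z, rfl⟩ := Q.mkQ_surjective z
  obtain ⟨r, rfl⟩ := Submodule.mkQ_surjective _ z
  exact ⟨Submodule.Quotient.mk r, rfl⟩

/-! ### Regular sequences: exchange and descent -/

open RingTheory.Sequence

/-- Prime avoidance: an ideal of zero divisors lies in one of the finitely many associated primes.
-/
theorem exists_isSMulRegular_or_exists_smul_eq_zero {A Y : Type*} [CommRing A] [IsNoetherianRing A]
    [AddCommGroup Y] [Module A Y] [Module.Finite A Y] (I : Ideal A) :
    (∃ x ∈ I, IsSMulRegular Y x) ∨ ∃ y : Y, y ≠ 0 ∧ ∀ a ∈ I, a • y = 0 := by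
  by_contra! H
  obtain ⟨h1, h2⟩ := H
  have hsub : (I : Set A) ⊆ ⋃ p ∈ associatedPrimes A Y, (p : Set A) := by
    rw [biUnion_associatedPrimes_eq_compl_regular A Y]
    exact h1
  obtain ⟨p, hp, hIp⟩ := (Ideal.subset_union_prime_finite (associatedPrimes.finite A Y)
    (f := id) ⊥ ⊥ fun p hp _ _ ↦ IsAssociatedPrime.isPrime hp).1 hsub
  obtain ⟨hprime, y, rfl⟩ := isAssociatedPrime_iff.1 (AssociatedPrimes.mem_iff.1 hp)
  obtain ⟨a, ha, hay⟩ := h2 y (by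
    rintro rfl
    exact hprime.ne_top (by simp))
  exact hay (by simpa using Submodule.mem_colon_singleton.1 (hIp ha))

/-- Iterated quotients `X / aX / bX` and `X / bX / aX` agree. -/
noncomputable def QuotSMulTop.commEquiv {A : Type*} [CommRing A] (X : Type*) [AddCommGroup X]
    [Module A X] (a b : A) :
    QuotSMulTop a (QuotSMulTop b X) ≃ₗ[A] QuotSMulTop b (QuotSMulTop a X) :=
  (QuotSMulTop.congr a (equivQuotTensor b X)).trans <| (equivQuotTensor a _).trans <|
    (TensorProduct.leftComm A _ _ _).trans <| (equivQuotTensor b _).symm.trans <|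
      (QuotSMulTop.congr b (equivQuotTensor a X)).symm

section

variable {A X : Type*} [CommRing A] [AddCommGroup X] [Module A X]

theorem QuotSMulTop.mk_eq_zero_iff {a : A} {x : X} :
    (Submodule.Quotient.mk x : QuotSMulTop a X) = 0 ↔ ∃ y : X, a • y = x := by
  rw [Submodule.Quotient.mk_eq_zero, Submodule.mem_smul_pointwise_iff_exists]
  simp

theorem isSMulRegular_quotSMulTop_iff {a b : A} :
    IsSMulRegular (QuotSMulTop a X) b ↔ ∀ u v : X, b • u = a • v → ∃ w, a • w = u := by
  rw [isSMulRegular_iff_right_eq_zero_of_smul]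
  constructor
  · intro h u v huv
    exact QuotSMulTop.mk_eq_zero_iff.1 (h (Submodule.Quotient.mk u)
      (QuotSMulTop.mk_eq_zero_iff.2 ⟨v, huv.symm⟩))
  · intro h u hu
    obtain ⟨u, rfl⟩ := Submodule.Quotient.mk_surjective _ u
    obtain ⟨v, hv⟩ := QuotSMulTop.mk_eq_zero_iff.1 hu
    exact QuotSMulTop.mk_eq_zero_iff.2 (h u v hv.symm)

theorem IsSMulRegular.quotSMulTop_symm {a b : A} (ha : IsSMulRegular X a)
    (hb : IsSMulRegular (QuotSMulTop a X) b) : IsSMulRegular (QuotSMulTop b X) a := by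
  rw [isSMulRegular_quotSMulTop_iff] at hb ⊢
  intro u v huv
  obtain ⟨w, rfl⟩ := hb v u huv.symm
  exact ⟨w, ha (by simpa only [smul_comm a b] using huv.symm)⟩

/-- An elementwise trace of `Hom(A/I, X/aX) ≅ Ext¹(A/I, X) ≅ Hom(A/I, X/bX)`: if `b u = a v`, the
class of `u` goes to that of `v`. -/
theorem exists_smul_eq_zero_quotSMulTop {I : Ideal A} {a b : A} (hbI : b ∈ I)
    (ha : IsSMulRegular X a) (hb : IsSMulRegular X b)
    (h : ∃ y : QuotSMulTop a X, y ≠ 0 ∧ ∀ r ∈ I, r • y = 0) :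
    ∃ y : QuotSMulTop b X, y ≠ 0 ∧ ∀ r ∈ I, r • y = 0 := by
  obtain ⟨u, hu, hIu⟩ := h
  obtain ⟨u, rfl⟩ := Submodule.Quotient.mk_surjective _ u
  obtain ⟨v, hv⟩ := QuotSMulTop.mk_eq_zero_iff.1 (hIu b hbI)
  refine ⟨Submodule.Quotient.mk v, fun hv0 ↦ hu ?_, fun r hr ↦ ?_⟩
  · obtain ⟨w, rfl⟩ := QuotSMulTop.mk_eq_zero_iff.1 hv0
    exact QuotSMulTop.mk_eq_zero_iff.2 ⟨w, hb (by simpa only [smul_comm a b] using hv)⟩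
  · obtain ⟨w, hw⟩ := QuotSMulTop.mk_eq_zero_iff.1 (hIu r hr)
    refine QuotSMulTop.mk_eq_zero_iff.2 ⟨w, ha ?_⟩
    change a • b • w = a • r • v
    rw [smul_comm a b, hw, smul_comm a r, hv, smul_comm]

end

/-- If `I` contains a weakly regular sequence of length `n + 1` on `X`, and `x ∈ I` is regular on
`X`, then `I` contains a weakly regular sequence of length `n` on `X / xX`. -/
theorem exists_isWeaklyRegular_quotSMulTop {A : Type*} [CommRing A] [IsNoetherianRing A]
    {I : Ideal A} {n : ℕ} {X : Type*} [AddCommGroup X] [Module A X] [Module.Finite A X]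
    (h : ∃ xs : List A, xs.length = n + 1 ∧ (∀ x ∈ xs, x ∈ I) ∧ IsWeaklyRegular X xs)
    {x : A} (hxI : x ∈ I) (hx : IsSMulRegular X x) :
    ∃ xs : List A, xs.length = n ∧ (∀ x ∈ xs, x ∈ I) ∧ IsWeaklyRegular (QuotSMulTop x X) xs := by
  induction n generalizing X x with
  | zero => exact ⟨[], by simp⟩
  | succ n ih =>
    obtain ⟨_ | ⟨a, _ | ⟨b, xs⟩⟩, hlen, hmem, hreg⟩ := h
    · simp at hlen
    · simp at hlen
    rw [isWeaklyRegular_cons_iff] at hreg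
    obtain ⟨ha, hreg⟩ := hreg
    have hb := ((isWeaklyRegular_cons_iff _ _ _).1 hreg).1
    have haI : a ∈ I := hmem a (by simp)
    have hbI : b ∈ I := hmem b (by simp)
    have hna : ¬ ∃ y : QuotSMulTop a X, y ≠ 0 ∧ ∀ r ∈ I, r • y = 0 := fun ⟨y, hy, hIy⟩ ↦
      hy (hb.right_eq_zero_of_smul (hIy b hbI))
    have hnx : ¬ ∃ y : QuotSMulTop x X, y ≠ 0 ∧ ∀ r ∈ I, r • y = 0 := fun H ↦
      hna (exists_smul_eq_zero_quotSMulTop haI hx ha H)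
    -- Applied to the product, avoidance gives one `z` regular on both quotients. Then `a` is
    -- exchanged for `z`, and `z` for `x`, by induction on `X / aX` and `X / zX`.
    obtain ⟨z, hzI, hz⟩ : ∃ z ∈ I, IsSMulRegular (QuotSMulTop a X × QuotSMulTop x X) z := by
      refine (exists_isSMulRegular_or_exists_smul_eq_zero I).resolve_right ?_
      rintro ⟨⟨y₁, y₂⟩, hy, hIy⟩
      by_cases h1 : y₁ = 0
      · exact hnx ⟨y₂, fun h2 ↦ hy (by simp [h1, h2]), fun r hr ↦ congrArg Prod.snd (hIy r hr)⟩
      · exact hna ⟨y₁, h1, fun r hr ↦ congrArg Prod.fst (hIy r hr)⟩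
    have hza : IsSMulRegular (QuotSMulTop a X) z := fun u v huv ↦
      congrArg Prod.fst (@hz (u, 0) (v, 0) (Prod.ext huv rfl))
    have hzx : IsSMulRegular (QuotSMulTop x X) z := fun u v huv ↦
      congrArg Prod.snd (@hz (0, u) (0, v) (Prod.ext rfl huv))
    obtain ⟨ys, hys, hysI, hysreg⟩ := ih ⟨b :: xs, by simpa using hlen,
      fun r hr ↦ hmem r (List.mem_cons_of_mem _ hr), hreg⟩ hzI hza
    obtain ⟨zs, hzs, hzsI, hzsreg⟩ := ih (X := QuotSMulTop z X) ⟨a :: ys, by simp [hys], by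
        rintro r hr
        obtain rfl | hr := List.mem_cons.1 hr
        exacts [haI, hysI r hr],
      IsWeaklyRegular.cons (ha.quotSMulTop_symm hza)
        (((QuotSMulTop.commEquiv X z a).isWeaklyRegular_congr _).1 hysreg)⟩
      hxI (hx.quotSMulTop_symm hzx)
    refine ⟨z :: zs, by simp [hzs], ?_, IsWeaklyRegular.cons hzx
      (((QuotSMulTop.commEquiv X x z).isWeaklyRegular_congr _).1 hzsreg)⟩
    intro r hr
    obtain rfl | hr := List.mem_cons.1 hr
    exacts [hzI, hzsI r hr]

/-- If every maximal ideal of `B` over `m` contains a weakly regular sequence of length `n` on a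
finite `B`-module `X`, then so does `m`. -/
theorem exists_isWeaklyRegular_map_of_forall_comap_eq {A B : Type*} [CommRing A] [CommRing B]
    [Algebra A B] [IsNoetherianRing A] [Module.Finite A B] (m : Ideal A) [hm : m.IsMaximal] (n : ℕ)
    (X : Type*) [AddCommGroup X] [Module B X] [Module.Finite B X]
    (h : ∀ M : Ideal B, M.IsMaximal → M.comap (algebraMap A B) = m →
      ∃ xs : List B, xs.length = n ∧ (∀ x ∈ xs, x ∈ M) ∧ IsWeaklyRegular X xs) :
    ∃ xs : List A, xs.length = n ∧ (∀ x ∈ xs, x ∈ m) ∧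
      IsWeaklyRegular X (xs.map (algebraMap A B)) := by
  have : IsNoetherianRing B := isNoetherian_of_tower A inferInstance
  induction n generalizing X with
  | zero => exact ⟨[], by simp⟩
  | succ n ih =>
    obtain ⟨x, hxm, hx⟩ : ∃ x ∈ m, IsSMulRegular X (algebraMap A B x) := by
      let _ : Module A X := Module.compHom X (algebraMap A B)
      have : IsScalarTower A B X := ⟨fun a b x ↦ by
        rw [Algebra.smul_def, mul_smul]; rfl⟩
      have : Module.Finite A X := Module.Finite.trans B X
      -- Otherwise `m` kills some `y ≠ 0`. An associated prime of the `B`-module `X` containing `Ann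
      -- y` lies over `m`, so it contains a regular element, yet it kills some `z ≠ 0`.
      refine (exists_isSMulRegular_or_exists_smul_eq_zero (Y := X) m).resolve_right ?_
      rintro ⟨y, hy, hmy⟩
      obtain ⟨P, hP, hyP⟩ := exists_le_isAssociatedPrime_of_isNoetherianRing B y hy
      obtain ⟨hPprime, z, rfl⟩ := isAssociatedPrime_iff.1 hP
      set P := (⊥ : Submodule B X).colon {z}
      have hmP : P.comap (algebraMap A B) = m := by
        refine (hm.eq_of_le (Ideal.IsPrime.ne_top inferInstance) fun a ha ↦ hyP ?_).symm
        exact Submodule.mem_colon_singleton.2 (hmy a ha)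
      have hPmax : P.IsMaximal := Ideal.isMaximal_of_isIntegral_of_isMaximal_comap P (hmP ▸ hm)
      obtain ⟨_ | ⟨a, xs⟩, hlen, hmem, hreg⟩ := h P hPmax hmP
      · simp at hlen
      have hz : a • z = 0 := by simpa using Submodule.mem_colon_singleton.1 (hmem a (by simp))
      have := ((isWeaklyRegular_cons_iff _ _ _).1 hreg).1.right_eq_zero_of_smul hz
      exact hPprime.ne_top (by simp [P, this])
    obtain ⟨xs, hlen, hmem, hreg⟩ := ih (QuotSMulTop (algebraMap A B x) X) fun M hM hMm ↦
      exists_isWeaklyRegular_quotSMulTop (h M hM hMm) (by rwa [← hMm] at hxm) hx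
    refine ⟨x :: xs, by simp [hlen], ?_, IsWeaklyRegular.cons hx hreg⟩
    intro r hr
    obtain rfl | hr := List.mem_cons.1 hr
    exacts [hxm, hmem r hr]

open CentrallyMacaulay

/-! ### Heights in integral extensions -/

section Height

variable {A B : Type*} [CommRing A] [CommRing B] [Algebra A B] [Algebra.IsIntegral A B]

/-- Incomparability: strict chains of primes contract to strict chains. -/
theorem Ideal.height_le_height_comap_of_isIntegral (M : Ideal B) [hM : M.IsPrime] :
    M.height ≤ (M.comap (algebraMap A B)).height := by
  have hmono : StrictMono (PrimeSpectrum.comap (algebraMap A B)) := fun P Q hPQ ↦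
    Ideal.IsIntegral.comap_lt_comap (R := A) hPQ
  have := Order.height_le_height_apply_of_strictMono _ hmono ⟨M, hM⟩
  rwa [← PrimeSpectrum.height_eq_orderHeight, ← PrimeSpectrum.height_eq_orderHeight] at this

/-- Lying over for the bottom of a chain below `m`, then going up. -/
theorem Ideal.exists_isMaximal_comap_eq_le_height [FaithfulSMul A B] (m : Ideal A)
    [hm : m.IsMaximal] {n : ℕ} (hn : n ≤ m.height) :
    ∃ M : Ideal B, M.IsMaximal ∧ M.comap (algebraMap A B) = m ∧ n ≤ M.height := by
  obtain ⟨l, hl, rfl⟩ := Order.exists_series_of_le_height (⟨m, hm.isPrime⟩ : PrimeSpectrum A)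
    (by rwa [← PrimeSpectrum.height_eq_orderHeight])
  obtain ⟨P, hP, hPl⟩ := (Ideal.nonempty_primesOver (S := B) l.head.asIdeal).some
  obtain ⟨L, hlen, -, hL⟩ := Ideal.exists_ltSeries_of_hasGoingUp l P
  have hlast : PrimeSpectrum.comap (algebraMap A B) L.last = l.last := by
    have hne : L.toList ≠ [] := RelSeries.toList_ne_nil L
    rw [← L.getLast_toList, ← l.getLast_toList,
      ← List.getLast_map (f := PrimeSpectrum.comap (algebraMap A B)) (by simpa using hne)]
    simp only [hL]
  rw [hl] at hlast
  have hcomap : L.last.asIdeal.comap (algebraMap A B) = m := congrArg PrimeSpectrum.asIdeal hlast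
  refine ⟨L.last.asIdeal, Ideal.isMaximal_of_isIntegral_of_isMaximal_comap _ (hcomap ▸ hm),
    hcomap, ?_⟩
  rw [PrimeSpectrum.height_eq_orderHeight, ← hlen]
  exact Order.length_le_height_last

end Height

/-! ### Grade and height for finite faithful modules -/

section Grade

variable {A X : Type*} [CommRing A] [AddCommGroup X] [Module A X] [Module.Finite A X]
  [FaithfulSMul A X]

theorem LocalizedModule.faithfulSMul_of_finite (S : Submonoid A) :
    FaithfulSMul (Localization S) (LocalizedModule S X) := by
  rw [← Module.annihilator_eq_bot, eq_bot_iff]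
  intro q hq
  induction q using Localization.induction_on with | H q =>
  obtain ⟨a, s⟩ := q
  have h : ∀ x : X, ∃ t : S, t • a • x = 0 := by
    intro x
    have := Module.mem_annihilator.1 hq (LocalizedModule.mk x 1)
    rw [LocalizedModule.mk_smul_mk, ← LocalizedModule.zero_mk 1, LocalizedModule.mk_eq] at this
    obtain ⟨u, hu⟩ := this
    exact ⟨u, by simpa using hu⟩
  choose t ht using h
  obtain ⟨σ, hσ⟩ := Module.Finite.fg_top (R := A) (M := X)
  -- A common denominator for the finitely many generators.
  let T : S := ∏ x ∈ σ, t x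
  have hT : ((T : A) * a) ∈ Module.annihilator A X := by
    rw [Module.mem_annihilator]
    have : (⊤ : Submodule A X) ≤ LinearMap.ker (LinearMap.lsmul A X ((T : A) * a)) := by
      rw [← hσ, Submodule.span_le]
      intro x hx
      obtain ⟨c, hc⟩ : t x ∣ T := Finset.dvd_prod_of_mem t hx
      have hx' : (t x : A) • a • x = 0 := ht x
      simp [hc, mul_smul, smul_comm _ (c : A), hx']
    exact fun x ↦ this (Submodule.mem_top (x := x))
  rw [Module.annihilator_eq_bot.2 ‹_›, Ideal.mem_bot] at hT
  rw [Ideal.mem_bot, Localization.mk_eq_mk', IsLocalization.mk'_eq_zero_iff]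
  exact ⟨T, hT⟩

theorem supportDim_localizedModule_eq_height (m : Ideal A) [m.IsPrime] :
    Module.supportDim (Localization.AtPrime m) (LocalizedModule.AtPrime m X) = m.height := by
  have : FaithfulSMul (Localization.AtPrime m) (LocalizedModule.AtPrime m X) :=
    LocalizedModule.faithfulSMul_of_finite m.primeCompl
  rw [Module.supportDim_eq_ringKrullDim_quotient_annihilator, Module.annihilator_eq_bot.2 this,
    ringKrullDim_eq_of_ringEquiv (RingEquiv.quotientBot _),
    IsLocalization.AtPrime.ringKrullDim_eq_height m]

theorem isMaximalCohenMacaulayModule_iff_forall_idealGrade_eq_height :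
    IsMaximalCohenMacaulayModule A X ↔ ∀ m : Ideal A, m.IsMaximal → idealGrade A m X = m.height := by
  unfold IsMaximalCohenMacaulayModule IsCohenMacaulayModule
  constructor
  · rintro ⟨-, h⟩ m hm
    have := h m
    rw [IsLocalization.AtPrime.ringKrullDim_eq_height m] at this
    exact_mod_cast this
  · refine fun h ↦ ⟨fun m hm ↦ ?_, fun m hm ↦ ?_⟩
    · rw [supportDim_localizedModule_eq_height, h m hm]
    · rw [IsLocalization.AtPrime.ringKrullDim_eq_height m, h m hm]

/-- Nakayama: otherwise an element congruent to 1 modulo the sequence would kill the faithful module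
`X`. -/
theorem RingTheory.Sequence.IsWeaklyRegular.isRegular_of_mem {I : Ideal A} (hI : I ≠ ⊤)
    {xs : List A} (hmem : ∀ x ∈ xs, x ∈ I) (hreg : IsWeaklyRegular X xs) : IsRegular X xs := by
  refine ⟨hreg, fun htop ↦ hI ?_⟩
  have hle : Ideal.ofList xs ≤ I := Ideal.span_le.2 hmem
  obtain ⟨r, hr, hr0⟩ := Submodule.exists_sub_one_mem_and_smul_eq_zero_of_fg_of_le_smul
    (Ideal.ofList xs) (⊤ : Submodule A X) Module.Finite.fg_top htop.le
  have : r ∈ Module.annihilator A X := Module.mem_annihilator.2 fun x ↦ hr0 x Submodule.mem_top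
  rw [Module.annihilator_eq_bot.2 ‹_›, Ideal.mem_bot] at this
  rw [this, zero_sub, neg_mem_iff] at hr
  exact (Ideal.eq_top_iff_one _).2 (hle hr)

/-- After localizing at `m`, each term of a regular sequence lowers the support dimension by one. -/
theorem idealGrade_le_height [IsNoetherianRing A] (m : Ideal A) [hm : m.IsPrime] :
    idealGrade A m X ≤ m.height := by
  refine iSup_le fun xs ↦ iSup_le fun hmem ↦ iSup_le fun hreg ↦ ?_
  have : FaithfulSMul (Localization.AtPrime m) (LocalizedModule.AtPrime m X) :=
    LocalizedModule.faithfulSMul_of_finite m.primeCompl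
  have : Nontrivial (LocalizedModule.AtPrime m X) := by
    by_contra H
    rw [not_nontrivial_iff_subsingleton] at H
    exact one_ne_zero (FaithfulSMul.eq_of_smul_eq_smul (M := Localization.AtPrime m)
      (α := LocalizedModule.AtPrime m X) fun x ↦ Subsingleton.elim _ _)
  have hloc := hreg.1.isRegular_of_isLocalizedModule_of_mem (Localization.AtPrime m) m
    (LocalizedModule.mkLinearMap m.primeCompl X) hmem
  have hdim := Module.supportDim_add_length_eq_supportDim_of_isRegular _ hloc
  rw [supportDim_localizedModule_eq_height, List.length_map] at hdim
  have hpos : (0 : WithBot ℕ∞) ≤ Module.supportDim (Localization.AtPrime m)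
      (LocalizedModule.AtPrime m X ⧸
        Ideal.ofList (xs.map (algebraMap A (Localization.AtPrime m))) •
          (⊤ : Submodule (Localization.AtPrime m) (LocalizedModule.AtPrime m X))) := by
    refine Order.krullDim_nonneg_iff.2 ?_
    rw [Set.nonempty_coe_sort, Module.nonempty_support_iff]
    exact hloc.quot_ofList_smul_nontrivial ⊤
  have : ((xs.length : ℕ∞) : WithBot ℕ∞) ≤ m.height := by
    rw [← hdim]
    simpa using add_le_add_left hpos _
  exact_mod_cast this

theorem natCast_le_idealGrade_iff [IsNoetherianRing A] (m : Ideal A) [hm : m.IsPrime] {n : ℕ} :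
    n ≤ idealGrade A m X ↔
      ∃ xs : List A, xs.length = n ∧ (∀ x ∈ xs, x ∈ m) ∧ IsWeaklyRegular X xs := by
  constructor
  · intro h
    obtain ⟨xs, hlen, hmem, hreg⟩ : ∃ xs : List A, n ≤ xs.length ∧ (∀ x ∈ xs, x ∈ m) ∧
        IsWeaklyRegular X xs := by
      obtain _ | n := n
      · exact ⟨[], by simp⟩
      by_contra! H
      have : idealGrade A m X ≤ n := by
        refine iSup_le fun xs ↦ iSup_le fun hmem ↦ iSup_le fun hreg ↦ ?_
        by_contra! hlt
        exact H xs (by exact_mod_cast hlt) hmem hreg.1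
      have := h.trans this
      norm_cast at this
      omega
    refine ⟨xs.take n, by simpa using hlen, fun x hx ↦ hmem x (List.mem_of_mem_take hx), ?_⟩
    rw [← List.take_append_drop n xs, isWeaklyRegular_append_iff] at hreg
    exact hreg.1
  · rintro ⟨xs, rfl, hmem, hreg⟩
    exact le_iSup_of_le xs (le_iSup_of_le hmem
      (le_iSup_of_le (hreg.isRegular_of_mem hm.ne_top hmem) le_rfl))

end Grade

theorem idealGrade_comap_le {A B X : Type*} [CommRing A] [CommRing B] [Algebra A B]
    [AddCommGroup X] [Module A X] [Module B X] [IsScalarTower A B X] [Module.Finite B X]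
    [FaithfulSMul B X] (M : Ideal B) [hM : M.IsPrime] :
    idealGrade A (M.comap (algebraMap A B)) X ≤ idealGrade B M X := by
  refine iSup_le fun xs ↦ iSup_le fun hmem ↦ iSup_le fun hreg ↦ ?_
  have hmem' : ∀ x ∈ xs.map (algebraMap A B), x ∈ M := by simpa using hmem
  refine le_iSup_of_le (xs.map (algebraMap A B)) (le_iSup_of_le hmem' (le_iSup_of_le ?_ (by simp)))
  exact ((isWeaklyRegular_map_algebraMap_iff B X xs).2 hreg.1).isRegular_of_mem hM.ne_top hmem'

/-! ### Comparing the Macaulay conditions over `A` and `B` -/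

section Descent

variable {A B X : Type*} [CommRing A] [CommRing B] [Algebra A B] [AddCommGroup X] [Module A X]
  [Module B X] [IsScalarTower A B X] [IsNoetherianRing A] [Module.Finite A B] [Module.Finite B X]
  [FaithfulSMul B X]

theorem idealGrade_eq_height_of_comap
    (h : ∀ m : Ideal A, m.IsMaximal → idealGrade A m X = m.height) (M : Ideal B)
    [hM : M.IsMaximal] :
    idealGrade B M X = M.height ∧ M.height = (M.comap (algebraMap A B)).height := by
  have : IsNoetherianRing B := isNoetherian_of_tower A inferInstance
  have h1 := h _ (Ideal.isMaximal_comap_of_isIntegral_of_isMaximal (R := A) M)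
  have h2 := idealGrade_comap_le (A := A) (X := X) M
  have h3 := idealGrade_le_height (X := X) M
  have h4 := Ideal.height_le_height_comap_of_isIntegral (A := A) M
  rw [h1] at h2
  exact ⟨h3.antisymm (h4.trans h2), h4.antisymm (h2.trans h3)⟩

variable [Module.Finite A X] [FaithfulSMul A X]

theorem idealGrade_eq_height_of_forall_comap [FaithfulSMul A B]
    (h : ∀ M : Ideal B, M.IsMaximal → idealGrade B M X = M.height)
    (hht : ∀ M N : Ideal B, M.IsMaximal → N.IsMaximal →
      M.comap (algebraMap A B) = N.comap (algebraMap A B) → M.height = N.height)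
    (m : Ideal A) [hm : m.IsMaximal] : idealGrade A m X = m.height := by
  have : IsNoetherianRing B := isNoetherian_of_tower A inferInstance
  refine (idealGrade_le_height m).antisymm (ENat.forall_natCast_le_iff_le.1 fun n hn ↦ ?_)
  -- One `N` over `m` has height at least `n`; equality of heights spreads this to every `M` over
  -- `m`.
  obtain ⟨N, hN, hNm, hnN⟩ := Ideal.exists_isMaximal_comap_eq_le_height (B := B) m hn
  rw [natCast_le_idealGrade_iff]
  obtain ⟨xs, hlen, hmem, hreg⟩ := exists_isWeaklyRegular_map_of_forall_comap_eq (B := B) m n X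
    fun M hM hMm ↦ (natCast_le_idealGrade_iff M).1 <| by
      rwa [h M hM, hht M N hM hN (hMm.trans hNm.symm)]
  exact ⟨xs, hlen, hmem, (isWeaklyRegular_map_algebraMap_iff B X xs).1 hreg⟩

theorem isMaximalCohenMacaulayModule_of_finite (h : IsMaximalCohenMacaulayModule A X) :
    IsMaximalCohenMacaulayModule B X := by
  rw [isMaximalCohenMacaulayModule_iff_forall_idealGrade_eq_height] at h ⊢
  exact fun M hM ↦ (idealGrade_eq_height_of_comap h M).1

/-- A maximal Cohen-Macaulay `B`-module is maximal Cohen-Macaulay over `A` if and only if maximal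
ideals of `B` with the same contraction to `A` have the same height. -/
theorem isMaximalCohenMacaulayModule_iff_forall_height_eq [FaithfulSMul A B]
    (h : IsMaximalCohenMacaulayModule B X) :
    IsMaximalCohenMacaulayModule A X ↔
      ∀ M N : Ideal B, M.IsMaximal → N.IsMaximal →
        M.comap (algebraMap A B) = N.comap (algebraMap A B) → M.height = N.height := by
  rw [isMaximalCohenMacaulayModule_iff_forall_idealGrade_eq_height] at h ⊢
  refine ⟨fun hA M N hM hN hMN ↦ ?_, fun hht m hm ↦ idealGrade_eq_height_of_forall_comap h hht m⟩
  rw [(idealGrade_eq_height_of_comap hA M).2, (idealGrade_eq_height_of_comap hA N).2, hMN]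

end Descent

open CentrallyMacaulay in
/-- A central subring of `R` is given as a subring `C` of the centre `Z(R) = Subring.center R`;
the contraction of an ideal `M` of `Z(R)` to `C` is `M.comap C.subtype`. -/
theorem mainTheorem8 {R : Type*} [Ring R] [IsNoetherianRing R]
    (C : Subring (Subring.center R)) [Module.Finite C R] :
    (IsMacaulayOver (Subring.center R) R →
      (IsMacaulayOver C R ↔
        ∀ M N : Ideal (Subring.center R), M.IsMaximal → N.IsMaximal →
          M.comap C.subtype = N.comap C.subtype → M.height = N.height)) ∧
    (IsEquicodimensional (Subring.center R) →
      (IsMacaulayOver (Subring.center R) R ↔ IsMacaulayOver C R)) := by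
  have hR : IsNoetherian C R := Algebra.isNoetherian_of_isNoetherianRing_of_finite C R
  have hC : IsNoetherianRing C := isNoetherian_of_injective (Algebra.linearMap C R)
    (FaithfulSMul.algebraMap_injective C R)
  have hZ : IsNoetherian C (Subring.center R) := isNoetherian_of_injective
    ((Algebra.linearMap (Subring.center R) R).restrictScalars C) Subtype.val_injective
  have : Module.Finite (Subring.center R) R := Module.Finite.of_restrictScalars_finite C _ R
  have key (h : IsMacaulayOver (Subring.center R) R) :=
    isMaximalCohenMacaulayModule_iff_forall_height_eq (A := C) (B := Subring.center R) (X := R) h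
  refine ⟨key, fun hequi ↦ ⟨fun h ↦ (key h).2 fun M N hM hN _ ↦ hequi M N hM hN, fun h ↦ ?_⟩⟩
  exact isMaximalCohenMacaulayModule_of_finite (A := C) (B := Subring.center R) (X := R) h
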